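/- Model $C$ (coalescing particles) is the Markov chain $(Z_n)_{n\ge 0}$ on $\{\circ,\bullet\}^{\mathbb Z}$ defined as follows. Let $(U_{i,n})_{i\in\mathbb Z,\,n\in\mathbb N}$ be i.i.d. random variables with $P(U_{i,n}=\uparrow)=P(U_{i,n}=\rightarrow)=1/2$, independent of $Z_0$. At step $n$, every particle (site $i$ with $Z_{i,n}=\bullet$) stays at its site $i$ if $U_{i,n}=\uparrow$ and jumps to $i+1$ if $U_{i,n}=\rightarrow$, all particles moving simultaneously; two particles arriving at the same site merge into one. Thus $Z_{i,n+1}=\bullet$ if and only if ($Z_{i-1,n}=\bullet$ and $U_{i-1,n}=\rightarrow$) or ($Z_{i,n}=\bullet$ and $U_{i,n}=\uparrow$). Suppose that $Z_0$ is (almost surely) the all-occupied configuration $\bullet^{\mathbb Z}$, and let $d_n=P(Z_{0,n}=\bullet)$ be the density of particles at time $n$. Then $P(Z_{k,n}=\bullet)=d_n$ for all $k\in\mathbb Z$ and $n\ge 0$. Let $T\in\mathbb N\cup\{\infty\}$ be the first time at which a simple symmetric random walk on $\mathbb Z$ started at $0$ reaches $2$. Then for all $n\ge 0$, $$d_n \;=\;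 P(T>2n)\;=\;4^{-n}\binom{2n+1}{n}.$$ In particular, $d_n\sim \dfrac{2}{\sqrt{\pi n}}$ as $n\to\infty$, and hence $d_n\to 0$. -/

import Mathlib

open MeasureTheory ProbabilityTheory Filter Topology Asymptotics

namespace ModelC

/-- The alphabet: a site is empty (white circle) or contains a particle (black circle). -/
inductive Site where
  | empty
  | particle
  deriving DecidableEq

/-- The update symbols: `up` means "stay at this site", `right` means "jump to the right". -/
inductive Arrow where
  | up
  | right
  deriving DecidableEq

instance : Fintype Site := ⟨{.empty, .particle}, fun x => by cases x <;> simp⟩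

instance : Fintype Arrow := ⟨{.up, .right}, fun x => by cases x <;> simp⟩

instance : MeasurableSpace Site := ⊤

instance : DiscreteMeasurableSpace Site := ⟨fun _ => trivial⟩

instance : MeasurableSpace Arrow := ⊤

instance : DiscreteMeasurableSpace Arrow := ⟨fun _ => trivial⟩

/-- The one-step update function of model `C` (coalescing particles on `ℤ`). -/
def step (z : ℤ → Site) (u : ℤ → Arrow) : ℤ → Site := fun i =>
  if (z (i - 1) = .particle ∧ z i = .empty ∧ u (i - 1) = .right) ∨
      (z (i - 1) = .empty ∧ z i = .particle ∧ u i = .up) ∨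
      (z (i - 1) = .particle ∧ z i = .particle ∧ u (i - 1) = .up ∧ u i = .up) ∨
      (z (i - 1) = .particle ∧ z i = .particle ∧ u (i - 1) = .right)
  then .particle
  else .empty

/-- The configuration with a particle at every site. -/
def allOccupied : ℤ → Site := fun _ => .particle

/-- An update process: i.i.d. fair variables `U i n` with values in `{up, right}`, indexed by the
site `i : ℤ` and the time `n : ℕ`. -/
structure IsUpdateProcess {Ω : Type*} [MeasurableSpace Ω] (P : Measure Ω)
    (U : ℤ → ℕ → Ω → Arrow) : Prop where
  measurable : ∀ i n, Measurable (U i n)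
  indep : iIndepFun (fun p : ℤ × ℕ => U p.1 p.2) P
  prob_up : ∀ i n, P {ω | U i n ω = .up} = 1 / 2
  prob_right : ∀ i n, P {ω | U i n ω = .right} = 1 / 2

/-- `Z` is a realization of model `C` driven by the update process `U`: the initial configuration
is independent of `U`, and `Z (n + 1)` is obtained from `Z n` and the updates at time `n`. The
state of site `k` at time `n` is `Z n ω k`. -/
structure IsRealization {Ω : Type*} [MeasurableSpace Ω] (P : Measure Ω)
    (U : ℤ → ℕ → Ω → Arrow) (Z : ℕ → Ω → ℤ → Site) : Prop where
  update : IsUpdateProcess P U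
  measurable_zero : Measurable (Z 0)
  indep_zero : IndepFun (Z 0) (fun ω (p : ℤ × ℕ) => U p.1 p.2 ω) P
  rec_step : ∀ n ω, Z (n + 1) ω = step (Z n ω) (fun i => U i n ω)

/-- The density of particles at time `n`: the probability that site `0` is occupied. -/
noncomputable def density {Ω : Type*} [MeasurableSpace Ω] (P : Measure Ω)
    (Z : ℕ → Ω → ℤ → Site) (n : ℕ) : ℝ :=
  P.real {ω | Z n ω 0 = .particle}

/-- `S` is a simple symmetric random walk on `ℤ` started at `0`. -/
structure IsSimpleRandomWalk {Ω : Type*} [MeasurableSpace Ω] (P : Measure Ω)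
    (S : ℕ → Ω → ℤ) : Prop where
  measurable : ∀ k, Measurable (S k)
  start : ∀ᵐ ω ∂P, S 0 ω = 0
  indep : iIndepFun (fun k ω => S (k + 1) ω - S k ω) P
  prob_one : ∀ k, P {ω | S (k + 1) ω - S k ω = 1} = 1 / 2
  prob_neg_one : ∀ k, P {ω | S (k + 1) ω - S k ω = -1} = 1 / 2

/-- The first time at which the walk is at `2` (`⊤` if it never is). -/
noncomputable def hitTwo {Ω : Type*} (S : ℕ → Ω → ℤ) : Ω → WithTop ℕ :=
  hittingAfter S {2} 0

end ModelC

/-!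
The argument is duality. The sites whose particles land, in one step, in an interval of `l ≥ 1`
consecutive sites again form an interval (`occupied_step_iff`): its interior is forced, and each of
its two ends is decided by a single fair update. The two updates sit at distinct sites, so they are
independent of each other and of the past, and the length of the dual interval changes by
`-1, 0, 1` with probabilities `1/4, 1/2, 1/4`. This is the law of half the displacement of a simple
random walk over two steps. Length `0` is absorbing (an empty interval contains no particle), and since every
site is occupied at time `0`, the original interval is occupied at time `n` exactly if the dual
interval still has positive length after `n` steps.

Hence the probability that an interval of `l` sites is occupied at time `n` and the probability that
a simple random walk avoids `2 * l` up to time `2 * n` obey the same recursion. Both are identified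
with the recursively defined numbers `survival (2 * n) (2 * l)`, in `measureReal_occupied_config`
and `measureReal_sum_ne`. In both, one conditions on the fresh updates by
`measureReal_eq_sum_of_indep`; translation invariance comes for free because the position of the
interval plays no role. The recursion is solved in closed form by `survival_even` (the reflection
principle), and the asymptotics of `4⁻ⁿ * C(2n+1, n)` follow from Wallis' product.
-/

namespace ModelC

/-! ### Survival probabilities of the simple random walk -/

/-- The probability that a simple symmetric random walk on `ℤ` started at `0` avoids `x` up to and
including time `m`, given by the recursion over the first step of the walk. -/
noncomputable def survival : ℕ → ℕ → ℝ
  | _, 0 => 0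
  | 0, _ + 1 => 1
  | m + 1, x + 1 => (survival m x + survival m (x + 2)) / 2

@[simp]
lemma survival_zero_right (m : ℕ) : survival m 0 = 0 := by cases m <;> simp [survival]

@[simp]
lemma survival_zero_succ (x : ℕ) : survival 0 (x + 1) = 1 := by simp [survival]

lemma survival_succ_succ (m x : ℕ) :
    survival (m + 1) (x + 1) = (survival m x + survival m (x + 2)) / 2 := by
  simp [survival]

lemma survival_two_steps (m x : ℕ) :
    survival (m + 2) (x + 2) =
      (survival m x + 2 * survival m (x + 2) + survival m (x + 4)) / 4 := by
  rw [survival_succ_succ, survival_succ_succ]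
  cases x with
  | zero => simp [survival_succ_succ]; ring
  | succ x => rw [survival_succ_succ]; ring

/-- The reflection principle at even times: a walk of `2 * n` steps avoiding `2 * l` is counted by
the positions in `[-2 * l, 2 * l)`, whose binomial coefficients pair up to those of row
`2 * n + 1`. -/
lemma survival_even (n l : ℕ) :
    survival (2 * n) (2 * l) =
      ((4 : ℝ) ^ n)⁻¹ * ∑ i ∈ Finset.range l, ((2 * n + 1).choose (n + 1 + i) : ℝ) := by
  induction n generalizing l with
  | zero =>
    cases l with
    | zero => simp
    | succ l =>
      rw [Finset.sum_range_succ', Finset.sum_eq_zero]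
      · simp [Nat.mul_succ]
      · intro i _
        simp [Nat.choose_eq_zero_of_lt (show 1 < 1 + (i + 1) by omega)]
  | succ n ih =>
    cases l with
    | zero => simp
    | succ l =>
      have hstep : ∀ j : ℕ, (2 * (n + 1) + 1).choose (j + 2) = (2 * n + 1).choose j
          + 2 * (2 * n + 1).choose (j + 1) + (2 * n + 1).choose (j + 2) := by
        intro j
        rw [show 2 * (n + 1) + 1 = 2 * n + 1 + 1 + 1 by ring]
        simp only [Nat.choose_succ_succ]
        ring
      have hsum : ∑ i ∈ Finset.range (l + 1), ((2 * (n + 1) + 1).choose (n + 1 + 1 + i) : ℝ) =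
          ∑ i ∈ Finset.range l, ((2 * n + 1).choose (n + 1 + i) : ℝ)
          + 2 * ∑ i ∈ Finset.range (l + 1), ((2 * n + 1).choose (n + 1 + i) : ℝ)
          + ∑ i ∈ Finset.range (l + 2), ((2 * n + 1).choose (n + 1 + i) : ℝ) := by
        induction l with
        | zero =>
          have h := hstep n
          have hsymm : (2 * n + 1).choose n = (2 * n + 1).choose (n + 1) :=
            (Nat.choose_symm_half n).symm
          rw [hsymm] at h
          simp only [Finset.sum_range_succ, Finset.sum_range_zero, add_zero, zero_add]
          rw [show n + 1 + 1 = n + 2 by ring, h]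
          push_cast
          ring
        | succ l ihl =>
          have h := hstep (n + 1 + l)
          rw [Finset.sum_range_succ, ihl, show n + 1 + 1 + (l + 1) = n + 1 + l + 2 by ring, h,
            Finset.sum_range_succ _ l, Finset.sum_range_succ _ (l + 2),
            Finset.sum_range_succ _ (l + 1), Finset.sum_range_succ _ l,
            show n + 1 + (l + 1) = n + 1 + l + 1 by ring,
            show n + 1 + (l + 2) = n + 1 + l + 2 by ring]
          push_cast
          ring
      rw [hsum, show 2 * (n + 1) = 2 * n + 2 by ring, show 2 * (l + 1) = 2 * l + 2 by ring,
        survival_two_steps, ih l, show 2 * l + 2 = 2 * (l + 1) by ring, ih (l + 1),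
        show 2 * l + 4 = 2 * (l + 2) by ring, ih (l + 2), pow_succ, mul_inv]
      ring

lemma survival_even_two (n : ℕ) :
    survival (2 * n) 2 = ((4 : ℝ) ^ n)⁻¹ * ((2 * n + 1).choose n : ℝ) := by
  have h := survival_even n 1
  simpa [Nat.choose_symm_half] using h

/-! ### Conditioning on independent variables -/

/-- The law of total probability over the values of a variable `T`, independent of all of the
events `A t`. -/
lemma measureReal_eq_sum_of_indep {Ω τ : Type*} {m₁ m₂ : MeasurableSpace Ω}
    [mΩ : MeasurableSpace Ω] [MeasurableSpace τ] [MeasurableSingletonClass τ]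
    {P : Measure Ω} [IsProbabilityMeasure P] (hm₁ : m₁ ≤ mΩ) (hm₂ : m₂ ≤ mΩ)
    (hind : Indep m₁ m₂ P) {T : Ω → τ} (hT : Measurable[m₂] T) {s : Finset τ}
    (hs : ∀ᵐ ω ∂P, T ω ∈ s) {A : τ → Set Ω} (hA : ∀ t, MeasurableSet[m₁] (A t)) :
    P.real {ω | ω ∈ A (T ω)} = ∑ t ∈ s, P.real {ω | T ω = t} * P.real (A t) := by
  have hTt : ∀ t, MeasurableSet[m₂] {ω | T ω = t} := fun t => hT (measurableSet_singleton t)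
  have hae : {ω | ω ∈ A (T ω)} =ᵐ[P] ⋃ t ∈ s, (A t ∩ {ω | T ω = t}) := by
    filter_upwards [hs] with ω hω
    apply propext
    change ω ∈ A (T ω) ↔ ω ∈ ⋃ t ∈ s, (A t ∩ {ω | T ω = t})
    simp [hω]
  rw [measureReal_congr hae, measureReal_biUnion_finset]
  · refine Finset.sum_congr rfl fun t _ => ?_
    have h := (Indep_iff m₁ m₂ P).1 hind _ _ (hA t) (hTt t)
    simp only [measureReal_def, h, ENNReal.toReal_mul]
    ring
  · intro t _ t' _ htt'
    refine Set.disjoint_left.2 ?_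
    rintro ω ⟨_, h⟩ ⟨_, h'⟩
    exact htt' (h.symm.trans h')
  · exact fun t _ => (hm₁ _ (hA t)).inter (hm₂ _ (hTt t))

lemma measurable_iSup_comap {Ω ι β : Type*} [MeasurableSpace β] (f : ι → Ω → β) {s : Set ι}
    {i : ι} (hi : i ∈ s) :
    Measurable[⨆ j ∈ s, MeasurableSpace.comap (f j) inferInstance] (f i) :=
  (comap_measurable (f i)).mono
    (le_iSup₂ (f := fun j (_ : j ∈ s) => MeasurableSpace.comap (f j) inferInstance) i hi) le_rfl

lemma indep_iSup_comap {Ω ι β : Type*} [mΩ : MeasurableSpace Ω] [MeasurableSpace β]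
    {P : Measure Ω} {f : ι → Ω → β} (hf : ∀ i, Measurable (f i)) (hind : iIndepFun f P)
    {s t : Set ι} (hst : Disjoint s t) :
    Indep (⨆ j ∈ s, MeasurableSpace.comap (f j) inferInstance)
      (⨆ j ∈ t, MeasurableSpace.comap (f j) inferInstance) P :=
  indep_iSup_of_disjoint (fun i => (hf i).comap_le) hind.iIndep hst

lemma iSup_comap_le {Ω ι β : Type*} [mΩ : MeasurableSpace Ω] [MeasurableSpace β]
    {f : ι → Ω → β} (hf : ∀ i, Measurable (f i)) (s : Set ι) :
    ⨆ j ∈ s, MeasurableSpace.comap (f j) inferInstance ≤ mΩ :=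
  iSup₂_le fun i _ => (hf i).comap_le

/-! ### The hitting time of the simple random walk -/

/-- First-step analysis: partial sums of i.i.d. fair signs avoid `x` up to time `m` with
probability `survival m x`. -/
lemma measureReal_sum_ne {Ω : Type*} [mΩ : MeasurableSpace Ω] {P : Measure Ω}
    [IsProbabilityMeasure P] (m x : ℕ) {X : ℕ → Ω → ℤ} (hX : ∀ k, Measurable (X k))
    (hind : iIndepFun X P) (hone : ∀ k, P {ω | X k ω = 1} = 1 / 2)
    (hneg : ∀ k, P {ω | X k ω = -1} = 1 / 2) :
    P.real {ω | ∀ j ≤ m, ∑ k ∈ Finset.range j, X k ω ≠ (x : ℤ)} = survival m x := by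
  induction m generalizing X x with
  | zero =>
    cases x with
    | zero => simp
    | succ x =>
      have h : (0 : ℤ) ≠ (x : ℤ) + 1 := by omega
      simp [h]
  | succ m ih =>
    cases x with
    | zero =>
      rw [survival_zero_right]
      convert measureReal_empty
      refine Set.eq_empty_iff_forall_notMem.2 fun ω h => ?_
      exact h 0 (Nat.zero_le _) (by simp)
    | succ x =>
      have hone' : P.real {ω | X 0 ω = 1} = 1 / 2 := by simp [measureReal_def, hone]
      have hneg' : P.real {ω | X 0 ω = -1} = 1 / 2 := by simp [measureReal_def, hneg]
      have hs : ∀ᵐ ω ∂P, X 0 ω ∈ ({1, -1} : Finset ℤ) := by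
        have hmeas : MeasurableSet {ω | X 0 ω ∈ ({1, -1} : Finset ℤ)} :=
          hX 0 (MeasurableSet.of_discrete (s := (({1, -1} : Finset ℤ) : Set ℤ)))
        refine (mem_ae_iff_prob_eq_one hmeas).2 ?_
        have : {ω | X 0 ω ∈ ({1, -1} : Finset ℤ)} = {ω | X 0 ω = 1} ∪ {ω | X 0 ω = -1} := by
          ext ω; simp
        rw [this, measure_union, hone, hneg, ENNReal.add_halves]
        · exact Set.disjoint_left.2 fun ω (h : X 0 ω = 1) (h' : X 0 ω = -1) => by omega
        · exact hX 0 (measurableSet_singleton _)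
      let A : ℤ → Set Ω := fun t =>
        {ω | ∀ j ≤ m, ∑ k ∈ Finset.range j, X (k + 1) ω ≠ ((x + 1 : ℕ) : ℤ) - t}
      have hA : ∀ t, MeasurableSet[⨆ j ∈ {j : ℕ | 1 ≤ j},
          MeasurableSpace.comap (X j) inferInstance] (A t) := by
        intro t
        have hsum : ∀ j, Measurable[⨆ j ∈ {j : ℕ | 1 ≤ j},
            MeasurableSpace.comap (X j) inferInstance]
            (fun ω => ∑ k ∈ Finset.range j, X (k + 1) ω) := fun j =>
          Finset.measurable_fun_sum _ fun k _ => measurable_iSup_comap X (by simp)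
        have : A t = ⋂ j ∈ Set.Iic m, (fun ω => ∑ k ∈ Finset.range j, X (k + 1) ω) ⁻¹'
            {((x + 1 : ℕ) : ℤ) - t}ᶜ := by
          ext ω; simp [A]
        rw [this]
        exact MeasurableSet.biInter (Set.to_countable _) fun j _ =>
          hsum j (measurableSet_singleton _).compl
      have hsplit : {ω | ∀ j ≤ m + 1, ∑ k ∈ Finset.range j, X k ω ≠ ((x + 1 : ℕ) : ℤ)} =
          {ω | ω ∈ A (X 0 ω)} := by
        ext ω
        constructor
        · intro h j hj he
          refine h (j + 1) (by omega) ?_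
          rw [Finset.sum_range_succ', he]
          ring
        · intro h j hj he
          cases j with
          | zero => simp at he; omega
          | succ j =>
            refine h j (by omega) ?_
            rw [Finset.sum_range_succ'] at he
            rw [← he]
            ring
      have hindep := indep_iSup_comap hX hind (s := {j : ℕ | 1 ≤ j}) (t := {0}) (by simp)
      have hprob : ∀ (y : ℕ) (t : ℤ), ((x + 1 : ℕ) : ℤ) - t = y → P.real (A t) = survival m y := by
        intro y t hy
        simp only [A, hy]
        exact ih y (X := fun k => X (k + 1)) (fun k => hX _)
          (hind.precomp (add_left_injective 1)) (fun k => hone _) (fun k => hneg _)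
      rw [hsplit, measureReal_eq_sum_of_indep (iSup_comap_le hX _) (iSup_comap_le hX _) hindep
        (measurable_iSup_comap X rfl) hs hA, Finset.sum_pair (by decide), hone', hneg',
        hprob x 1 (by push_cast; ring), hprob (x + 2) (-1) (by push_cast; ring),
        survival_succ_succ]
      ring

lemma IsSimpleRandomWalk.measureReal_lt_hitTwo {Ω : Type*} [MeasurableSpace Ω] {Q : Measure Ω}
    [IsProbabilityMeasure Q] {S : ℕ → Ω → ℤ} (hS : IsSimpleRandomWalk Q S) (m : ℕ) :
    Q.real {ω | (m : WithTop ℕ) < hitTwo S ω} = survival m 2 := by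
  rw [← measureReal_sum_ne m 2 (fun k => (hS.measurable (k + 1)).sub (hS.measurable k)) hS.indep
    hS.prob_one hS.prob_neg_one]
  refine measureReal_congr ?_
  filter_upwards [hS.start] with ω hω
  apply propext
  change (m : WithTop ℕ) < hittingAfter S {2} 0 ω ↔
    ∀ j ≤ m, ∑ k ∈ Finset.range j, (S (k + 1) ω - S k ω) ≠ ((2 : ℕ) : ℤ)
  have h := hittingAfter_le_iff (u := S) (s := {2}) (n := 0) (i := m) (ω := ω)
  rw [← not_le]
  refine (not_congr h).trans ?_
  simp [Finset.sum_range_sub (fun k => S k ω), hω]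

/-! ### Intervals and the dual interval -/

/-- The interval of `l` sites starting at `a` contains a particle of `z`. -/
def Occupied (z : ℤ → Site) (a : ℤ) (l : ℕ) : Prop :=
  ∃ i, a ≤ i ∧ i < a + l ∧ z i = .particle

/-- Length of the dual interval: the update at the site left of an interval of `l + 1` sites adds
one site if it is `right`, and the update at its last site adds one if it is `up`. -/
def dualLength (l : ℕ) (t : Arrow × Arrow) : ℕ :=
  (if t.1 = .right then 1 else 0) + l + (if t.2 = .up then 1 else 0)

/-- Left end of the dual interval of an interval starting at `a`. -/
def dualStart (a : ℤ) (t : Arrow × Arrow) : ℤ :=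
  if t.1 = .right then a - 1 else a

lemma step_eq_particle_iff (z : ℤ → Site) (u : ℤ → Arrow) (i : ℤ) :
    step z u i = .particle ↔
      (z (i - 1) = .particle ∧ u (i - 1) = .right) ∨ (z i = .particle ∧ u i = .up) := by
  unfold step
  cases z (i - 1) <;> cases z i <;> cases u (i - 1) <;> cases u i <;> simp

/-- The sites whose particles land in an interval form the dual interval. Both of its ends are
decided by the updates at two distinct sites, `a - 1` and `a + l`. -/
lemma occupied_step_iff (z : ℤ → Site) (u : ℤ → Arrow) (a : ℤ) (l : ℕ) :
    Occupied (step z u) a (l + 1) ↔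
      Occupied z (dualStart a (u (a - 1), u (a + l))) (dualLength l (u (a - 1), u (a + l))) := by
  constructor
  · rintro ⟨i, h1, h2, h3⟩
    push_cast at h2
    rw [step_eq_particle_iff] at h3
    rcases h3 with ⟨hz, hu⟩ | ⟨hz, hu⟩
    · refine ⟨i - 1, ?_, ?_, hz⟩
      · unfold dualStart
        split_ifs with h
        · omega
        · have : i ≠ a := by rintro rfl; exact h hu
          omega
      · unfold dualStart dualLength
        split_ifs <;> push_cast <;> omega
    · refine ⟨i, ?_, ?_, hz⟩
      · unfold dualStart
        split_ifs <;> omega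
      · have hr : i = a + l → u (a + l) = .up := by rintro rfl; exact hu
        unfold dualStart dualLength
        by_cases h : u (a + l) = .up
        · simp only [h, if_true]
          split_ifs <;> push_cast <;> omega
        · have : i ≠ a + l := fun hi => h (hr hi)
          simp only [h, if_false]
          split_ifs <;> push_cast <;> omega
  · rintro ⟨i, h1, h2, h3⟩
    have key : ∀ j, a ≤ j → j < a + (l + 1) → step z u j = .particle →
        Occupied (step z u) a (l + 1) := fun j h h' h'' => ⟨j, h, by push_cast; exact h', h''⟩
    unfold dualStart at h1 h2
    unfold dualLength at h2
    cases hu : u i with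
    | right =>
      have hr : i = a + l → u (a + l) = .right := by rintro rfl; exact hu
      refine key (i + 1) ?_ ?_ ?_
      · split_ifs at h1 <;> omega
      · by_cases h : u (a + l) = .up
        · have : i ≠ a + l := fun hi => by rw [hr hi] at h; cases h
          simp only [h, if_true] at h2
          split_ifs at h2 <;> push_cast at h2 <;> omega
        · simp only [h, if_false] at h2
          split_ifs at h2 <;> push_cast at h2 <;> omega
      · rw [step_eq_particle_iff]
        left
        simpa using ⟨h3, hu⟩
    | up =>
      have hr : i = a - 1 → u (a - 1) = .up := by rintro rfl; exact hu
      refine key i ?_ ?_ ?_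
      · by_cases h : u (a - 1) = .right
        · have : i ≠ a - 1 := fun hi => by rw [hr hi] at h; cases h
          simp only [h, if_true] at h1
          omega
        · simp only [h, if_false] at h1
          exact h1
      · split_ifs at h2 <;> push_cast at h2 <;> omega
      · rw [step_eq_particle_iff]
        exact Or.inr ⟨h3, hu⟩

/-! ### Density of the coalescing particles -/

/-- The configuration at time `n`, started with every site occupied and driven by `u`. -/
def config (u : ℤ → ℕ → Arrow) : ℕ → ℤ → Site
  | 0 => allOccupied
  | n + 1 => step (config u n) (fun i => u i n)

lemma measurableSet_config_eq_particle {Ω : Type*} {U : ℤ → ℕ → Ω → Arrow} (n : ℕ) (i : ℤ) :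
    MeasurableSet[⨆ p ∈ {p : ℤ × ℕ | p.2 < n},
      MeasurableSpace.comap (fun ω => U p.1 p.2 ω) inferInstance]
      {ω | config (fun i n => U i n ω) n i = .particle} := by
  induction n generalizing i with
  | zero => simp [config, allOccupied]
  | succ n ih =>
    have hu : ∀ (j : ℤ) (t : Arrow), MeasurableSet[⨆ p ∈ {p : ℤ × ℕ | p.2 < n + 1},
        MeasurableSpace.comap (fun ω => U p.1 p.2 ω) inferInstance] {ω | U j n ω = t} :=
      fun j t => measurable_iSup_comap (fun p : ℤ × ℕ => fun ω => U p.1 p.2 ω) (i := (j, n))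
        (by simp) (measurableSet_singleton t)
    have hz : ∀ j : ℤ, MeasurableSet[⨆ p ∈ {p : ℤ × ℕ | p.2 < n + 1},
        MeasurableSpace.comap (fun ω => U p.1 p.2 ω) inferInstance]
        {ω | config (fun i n => U i n ω) n j = .particle} := by
      intro j
      have hle : ⨆ p ∈ {p : ℤ × ℕ | p.2 < n},
          MeasurableSpace.comap (fun ω => U p.1 p.2 ω) inferInstance ≤
          ⨆ p ∈ {p : ℤ × ℕ | p.2 < n + 1},
          MeasurableSpace.comap (fun ω => U p.1 p.2 ω) inferInstance :=
        biSup_mono fun p (hp : p.2 < n) => show p.2 < n + 1 by omega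
      exact hle _ (ih j)
    have : {ω | config (fun i n => U i n ω) (n + 1) i = .particle} =
        ({ω | config (fun i n => U i n ω) n (i - 1) = .particle} ∩ {ω | U (i - 1) n ω = .right}) ∪
        ({ω | config (fun i n => U i n ω) n i = .particle} ∩ {ω | U i n ω = .up}) := by
      ext ω
      simp only [config, Set.mem_ofPred_eq, step_eq_particle_iff, Set.mem_union, Set.mem_inter_iff]
    rw [this]
    exact ((hz _).inter (hu _ _)).union ((hz _).inter (hu _ _))

lemma measurableSet_occupied_config {Ω : Type*} {U : ℤ → ℕ → Ω → Arrow} (n : ℕ) (a : ℤ) (l : ℕ) :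
    MeasurableSet[⨆ p ∈ {p : ℤ × ℕ | p.2 < n},
      MeasurableSpace.comap (fun ω => U p.1 p.2 ω) inferInstance]
      {ω | Occupied (config (fun i n => U i n ω) n) a l} := by
  have : {ω | Occupied (config (fun i n => U i n ω) n) a l} =
      ⋃ i ∈ Set.Ico a (a + l), {ω | config (fun i n => U i n ω) n i = .particle} := by
    ext ω
    simp [Occupied, and_assoc]
  rw [this]
  exact MeasurableSet.biUnion (Set.to_countable _) fun i _ =>
    measurableSet_config_eq_particle n i

section

variable {Ω : Type*} [MeasurableSpace Ω] {P : Measure Ω} {U : ℤ → ℕ → Ω → Arrow}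

lemma IsUpdateProcess.measureReal_pair_eq [IsProbabilityMeasure P] (hU : IsUpdateProcess P U)
    {i j : ℤ} (hij : i ≠ j) (n : ℕ) (t : Arrow × Arrow) :
    P.real {ω | (U i n ω, U j n ω) = t} = 1 / 4 := by
  have hhalf : ∀ (i : ℤ) (s : Arrow), P (U i n ⁻¹' {s}) = 1 / 2 := by
    rintro i (_ | _)
    · exact hU.prob_up i n
    · exact hU.prob_right i n
  have hset : {ω | (U i n ω, U j n ω) = t} = U i n ⁻¹' {t.1} ∩ U j n ⁻¹' {t.2} := by
    ext ω
    simp [Prod.ext_iff]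
  have hind := (hU.indep.indepFun (i := (i, n)) (j := (j, n)) (by simpa using hij))
  have h := hind.measure_inter_preimage_eq_mul {t.1} {t.2} (measurableSet_singleton _)
    (measurableSet_singleton _)
  rw [hset, measureReal_def]
  dsimp only at h
  rw [h, hhalf, hhalf, ENNReal.toReal_mul]
  norm_num

/-- Duality: an interval of `l` sites is occupied at time `n` exactly if the dual interval has not
died out, and twice its length evolves as the distance to `2 * l` of a simple random walk observed
at even times, stopped when that distance vanishes. -/
lemma IsUpdateProcess.measureReal_occupied_config [IsProbabilityMeasure P]
    (hU : IsUpdateProcess P U) (n : ℕ) (a : ℤ) (l : ℕ) :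
    P.real {ω | Occupied (config (fun i n => U i n ω) n) a l} = survival (2 * n) (2 * l) := by
  have hempty : ∀ (n : ℕ) (a : ℤ),
      {ω | Occupied (config (fun i n => U i n ω) n) a 0} = ∅ := by
    refine fun n a => Set.eq_empty_iff_forall_notMem.2 ?_
    rintro ω ⟨i, h1, h2, -⟩
    push_cast at h2
    omega
  induction n generalizing a l with
  | zero =>
    cases l with
    | zero => simp [hempty]
    | succ l =>
      have : {ω | Occupied (config (fun i n => U i n ω) 0) a (l + 1)} = Set.univ := by
        refine Set.eq_univ_of_forall fun ω => ⟨a, le_rfl, ?_, rfl⟩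
        push_cast
        omega
      rw [this]
      simp [Nat.mul_succ]
  | succ n ih =>
    cases l with
    | zero => simp [hempty]
    | succ l =>
      have hm : ∀ p : ℤ × ℕ, Measurable (fun ω => U p.1 p.2 ω) := fun p => hU.measurable _ _
      have hsplit : {ω | Occupied (config (fun i n => U i n ω) (n + 1)) a (l + 1)} =
          {ω | ω ∈ (fun t : Arrow × Arrow =>
            {ω | Occupied (config (fun i n => U i n ω) n) (dualStart a t) (dualLength l t)})
            (U (a - 1) n ω, U (a + l) n ω)} := by
        ext ω
        exact occupied_step_iff _ _ a l
      have hT : Measurable[⨆ p ∈ {p : ℤ × ℕ | p.2 = n},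
          MeasurableSpace.comap (fun ω => U p.1 p.2 ω) inferInstance]
          (fun ω => (U (a - 1) n ω, U (a + l) n ω)) :=
        Measurable.prodMk
          (measurable_iSup_comap (fun p : ℤ × ℕ => fun ω => U p.1 p.2 ω) (i := (a - 1, n)) rfl)
          (measurable_iSup_comap (fun p : ℤ × ℕ => fun ω => U p.1 p.2 ω) (i := (a + l, n)) rfl)
      have hindep := indep_iSup_comap hm hU.indep (s := {p : ℤ × ℕ | p.2 < n})
        (t := {p : ℤ × ℕ | p.2 = n})
        (Set.disjoint_left.2 fun p (h : p.2 < n) (h' : p.2 = n) => by omega)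
      rw [hsplit, measureReal_eq_sum_of_indep (iSup_comap_le hm _) (iSup_comap_le hm _) hindep hT
        (s := Finset.univ) (by simp)
        (fun t => measurableSet_occupied_config n (dualStart a t) (dualLength l t))]
      simp only [ih, hU.measureReal_pair_eq (show a - 1 ≠ a + l by omega)]
      have huniv : (Finset.univ : Finset Arrow) = {.up, .right} := rfl
      rw [Fintype.sum_prod_type, huniv, Finset.sum_pair (by simp), Finset.sum_pair (by simp),
        Finset.sum_pair (by simp)]
      simp only [dualLength, if_true, reduceCtorEq, if_false]
      rw [show 2 * (n + 1) = 2 * n + 2 by ring, show 2 * (l + 1) = 2 * l + 2 by ring,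
        survival_two_steps, show 2 * (0 + l + 1) = 2 * l + 2 by ring,
        show 2 * (0 + l + 0) = 2 * l by ring, show 2 * (1 + l + 1) = 2 * l + 4 by ring,
        show 2 * (1 + l + 0) = 2 * l + 2 by ring]
      ring

lemma IsRealization.measureReal_particle [IsProbabilityMeasure P] {Z : ℕ → Ω → ℤ → Site}
    (hZ : IsRealization P U Z) (hZ0 : ∀ᵐ ω ∂P, Z 0 ω = allOccupied) (n : ℕ) (k : ℤ) :
    P.real {ω | Z n ω k = .particle} = survival (2 * n) 2 := by
  rw [show survival (2 * n) 2 = survival (2 * n) (2 * 1) by rfl,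
    ← hZ.update.measureReal_occupied_config n k 1]
  refine measureReal_congr ?_
  filter_upwards [hZ0] with ω hω
  have hconfig : ∀ n, Z n ω = config (fun i n => U i n ω) n := by
    intro n
    induction n with
    | zero => exact hω
    | succ n ih => rw [hZ.rec_step, ih, config]
  apply propext
  change Z n ω k = .particle ↔ Occupied (config (fun i n => U i n ω) n) k 1
  rw [hconfig]
  constructor
  · exact fun h => ⟨k, le_rfl, by simp, h⟩
  · rintro ⟨i, h1, h2, h3⟩
    obtain rfl : i = k := by push_cast at h2; omega
    exact h3

end

/-! ### Asymptotics -/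

/-- The square of `4⁻ⁿ * C(2n+1, n)` in terms of Wallis' partial products. -/
lemma sq_choose_half_eq (n : ℕ) :
    (((4 : ℝ) ^ n)⁻¹ * ((2 * n + 1).choose n : ℝ)) ^ 2 =
      (2 * n + 1) / ((n + 1) ^ 2 * Real.Wallis.W n) := by
  have hchoose : ((2 * n + 1).choose n : ℝ) =
      (2 * n + 1) * (Nat.factorial (2 * n)) / ((n + 1) * (Nat.factorial n : ℝ) ^ 2) := by
    rw [Nat.cast_choose ℝ (by omega), show 2 * n + 1 - n = n + 1 by omega,
      Nat.factorial_succ, Nat.factorial_succ]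
    push_cast
    field_simp
  have h16 : (2 : ℝ) ^ (4 * n) = (4 ^ n) ^ 2 := by
    rw [← pow_mul, show (4 : ℝ) = 2 ^ 2 by norm_num, ← pow_mul]
    congr 1
    ring
  rw [hchoose, Real.Wallis.W_eq_factorial_ratio, h16]
  have h1 : (Nat.factorial n : ℝ) ≠ 0 := by positivity
  have h2 : (Nat.factorial (2 * n) : ℝ) ≠ 0 := by positivity
  field_simp

lemma choose_half_isEquivalent :
    (fun n : ℕ => ((4 : ℝ) ^ n)⁻¹ * ((2 * n + 1).choose n : ℝ)) ~[atTop]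
      (fun n : ℕ => 2 / √(Real.pi * n)) := by
  rw [isEquivalent_iff_tendsto_one]
  swap
  · filter_upwards [eventually_gt_atTop 0] with n hn
    have : (0 : ℝ) < n := by exact_mod_cast hn
    positivity
  -- The squared ratio is a rational function of `n` over Wallis' product.
  have hinv : Tendsto (fun n : ℕ => ((n : ℝ))⁻¹) atTop (𝓝 0) := tendsto_inv_atTop_nhds_zero_nat
  have hlim : Tendsto (fun n : ℕ => (2 + (n : ℝ)⁻¹) * Real.pi /
      (4 * (1 + (n : ℝ)⁻¹) ^ 2 * Real.Wallis.W n)) atTop (𝓝 1) := by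
    have h := ((hinv.const_add 2).mul_const Real.pi).div
      ((((hinv.const_add 1).pow 2).const_mul 4).mul Real.Wallis.tendsto_W_nhds_pi_div_two)
      (by positivity)
    have hval : (2 + 0) * Real.pi / (4 * (1 + 0) ^ 2 * (Real.pi / 2)) = 1 := by
      field_simp
      norm_num
    rw [hval] at h
    exact h
  have hsqrt := hlim.sqrt
  rw [Real.sqrt_one] at hsqrt
  refine hsqrt.congr' ?_
  filter_upwards [eventually_gt_atTop 0] with n hn
  have hn' : (0 : ℝ) < n := by exact_mod_cast hn
  have hW := Real.Wallis.W_pos n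
  rw [Real.sqrt_eq_iff_mul_self_eq (by positivity) (by simp only [Pi.div_apply]; positivity),
    ← sq, Pi.div_apply, div_pow, sq_choose_half_eq, div_pow, Real.sq_sqrt (by positivity)]
  field_simp
  ring

lemma tendsto_two_div_sqrt_pi_mul :
    Tendsto (fun n : ℕ => 2 / √(Real.pi * n)) atTop (𝓝 0) :=
  tendsto_const_nhds.div_atTop
    (Real.tendsto_sqrt_atTop.comp (tendsto_natCast_atTop_atTop.const_mul_atTop Real.pi_pos))

end ModelC

theorem theorem2
    {Ω : Type*} [MeasurableSpace Ω] (P : Measure Ω) [IsProbabilityMeasure P]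
    (U : ℤ → ℕ → Ω → ModelC.Arrow) (Z : ℕ → Ω → ℤ → ModelC.Site)
    (hZ : ModelC.IsRealization P U Z) (hZ0 : ∀ᵐ ω ∂P, Z 0 ω = ModelC.allOccupied)
    {Ω' : Type*} [MeasurableSpace Ω'] (Q : Measure Ω') [IsProbabilityMeasure Q]
    (S : ℕ → Ω' → ℤ) (hS : ModelC.IsSimpleRandomWalk Q S) :
    (∀ (n : ℕ) (k : ℤ),
      P.real {ω | Z n ω k = ModelC.Site.particle} = ModelC.density P Z n) ∧
    (∀ n : ℕ, ModelC.density P Z n =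
      Q.real {ω | ((2 * n : ℕ) : WithTop ℕ) < ModelC.hitTwo S ω}) ∧
    (∀ n : ℕ, ModelC.density P Z n = ((4 : ℝ) ^ n)⁻¹ * ((2 * n + 1).choose n : ℝ)) ∧
    (fun n : ℕ => ModelC.density P Z n) ~[atTop] (fun n : ℕ => 2 / √(Real.pi * n)) ∧
    Tendsto (fun n : ℕ => ModelC.density P Z n) atTop (𝓝 0) := by

  have hdensity : ∀ n : ℕ, ModelC.density P Z n =
      ((4 : ℝ) ^ n)⁻¹ * ((2 * n + 1).choose n : ℝ) := fun n =>
    (hZ.measureReal_particle hZ0 n 0).trans (ModelC.survival_even_two n)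
  have hequiv : (fun n : ℕ => ModelC.density P Z n) ~[atTop]
      (fun n : ℕ => 2 / √(Real.pi * n)) := by
    simpa only [hdensity] using ModelC.choose_half_isEquivalent
  refine ⟨fun n k => ?_, fun n => ?_, hdensity, hequiv,
    hequiv.symm.tendsto_nhds ModelC.tendsto_two_div_sqrt_pi_mul⟩
  · rw [ModelC.density, hZ.measureReal_particle hZ0, hZ.measureReal_particle hZ0]
  · rw [hS.measureReal_lt_hitTwo, ModelC.density, hZ.measureReal_particle hZ0]
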